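/- Throughout, $X,Y$ are compact Hausdorff spaces, $\exp X$ is the set of non-empty closed subsets of $X$ with the Vietoris topology, and $L$ is a compact Hausdorff Lawson lattice, i.e. a distributive topological lattice (with bottom $0$ and top $1$) in which every point has a local base of join-subsemilattices and a local base of meet-subsemilattices. Write $\beta\ll\alpha$ if for every non-empty directed $D\subset L$ with $\alpha\le\sup D$ there is $\gamma\in D$ with $\beta\le\gamma$. An $L$-ambiguous representation between $X$ and $Y$ is a set $R\subset\exp X\times\exp Y\times L$ such that: (a) if $(A,B,\alpha)\in R$, $A'\subset A$, $B\subset B'$, $\alpha'\le\alpha$, then $(A',B',\alpha')\in R$; (b) $(A,B,\alpha),(A,B,\beta)\in R$ implies $(A,B,\alpha\vee\beta)\in R$; (c) $(A,Y,\alpha)\in R$ and $(A,B,0)\in R$ for all $A,B,\alpha$; (d) for each $A$ the set $\{(B,\alpha)\mid(A,B,\alpha)\in R\}$ is closed in $\exp Y\times L$. The set $\mathrm{Camb}_L(X,Y)$ of all of them is ordered by inclusion; it is a lattice with $R\wedge S=R\cap S$ and $R\vee S=\{(A,B,\alpha_1\vee\alpha_2)\mid(A,B,\alpha_1)\in R,\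 (A,B,\alpha_2)\in S\}$. $R$ is strict if for each $B$ the set $\{(A,\alpha)\mid(A,B,\alpha)\in R\}$ is closed in $\exp X\times L$. Define $R^{-1}\in\mathrm{Camb}_L(Y,X)$ by: $(B,A,\alpha)\in R^{-1}$ if and only if $\alpha=0$ or, for every $\beta\ll\alpha$ and every $A'\in\exp X$ with $A'\cap A=\varnothing$, there is $B'\in\exp Y$ with $B'\cap B=\varnothing$ and $(A',B',\beta)\in R$. $R$ is pseudo-invertible if $(R^{-1})^{-1}=R$, and open if it is pseudo-invertible and both $R$ and $R^{-1}$ are strict. Theorem. (1) For all $R,S\in\mathrm{Camb}_L(X,Y)$, $$(R\vee S)^{-1}=R^{-1}\vee S^{-1},\qquad (R\wedge S)^{-1}=R^{-1}\wedge S^{-1}.$$ (2) The sets of pseudo-invertible, of pseudo-invertible strict, and of open $L$-ambiguous representations are each closed under the pairwise joins and meets of $\mathrm{Camb}_L(X,Y)$, i.e. they are sublattices of $\mathrm{Camb}_L(X,Y)$. (3) (Crisp analogue.) Call $R\subset\exp X\times\exp Y$ an ambiguous representation if $(A,B)\in R$, $A'\subset A$, $B\subset B'$ imply $(A',B')\in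 R$, if $(A,Y)\in R$ for all $A$, and if $\{B\mid(A,B)\in R\}$ is closed in $\exp Y$ for all $A$; it is strict if moreover $\{A\mid(A,B)\in R\}$ is closed in $\exp X$ for all $B$. Let $R^{-1}$ be the set of $(B,A)\in\exp Y\times\exp X$ such that for every $A'\in\exp X$ with $A'\cap A=\varnothing$ there is $B'\in\exp Y$ with $B'\cap B=\varnothing$ and $(A',B')\in R$. Call $R$ open if $R$ and $R^{-1}$ are strict ambiguous representations and $(R^{-1})^{-1}=R$. If $R,S\subset\exp X\times\exp Y$ are open ambiguous representations, then so are $R\cap S$ and $R\cup S$. -/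

import Mathlib

open Set Filter Topology TopologicalSpace

namespace AmbRep

universe u v w

/-! ### Compact Lawson lattices and the way-below relation -/

/-- A Lawson lattice: a distributive topological lattice in which every point has a local base
of (not necessarily open) join-subsemilattices and a local base of meet-subsemilattices. -/
class LawsonLattice (L : Type w) [DistribLattice L] [TopologicalSpace L] : Prop
    extends TopologicalLattice L where
  sup_base : ∀ x : L, ∀ U ∈ 𝓝 x, ∃ V ∈ 𝓝 x, V ⊆ U ∧ SupClosed V
  inf_base : ∀ x : L, ∀ U ∈ 𝓝 x, ∃ V ∈ 𝓝 x, V ⊆ U ∧ InfClosed V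

/-- `WayBelow a b` : whenever a (nonempty) directed set has a supremum above `b`, some element of
the directed set is above `a`. -/
def WayBelow {L : Type w} [Preorder L] (a b : L) : Prop :=
  ∀ D : Set L, D.Nonempty → DirectedOn (· ≤ ·) D → ∀ s : L, IsLUB D s → b ≤ s → ∃ c ∈ D, a ≤ c

theorem WayBelow.of_le {L : Type w} [Preorder L] {a a' b b' : L} (h : WayBelow a b) (ha : a' ≤ a) (hb : b ≤ b') :
    WayBelow a' b' := by
  intro D hne hdir s hs hbs
  obtain ⟨c, hc, hac⟩ := h D hne hdir s hs (hb.trans hbs)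
  exact ⟨c, hc, ha.trans hac⟩

theorem wayBelow_bot {L : Type w} [Preorder L] [OrderBot L] (a : L) : WayBelow (⊥ : L) a := by
  rintro D ⟨d, hd⟩ - s - -
  exact ⟨d, hd, bot_le⟩

section LatticeFacts

variable {L : Type w} [DistribLattice L] [TopologicalSpace L] [T2Space L] [LawsonLattice L]

theorem isClosed_le_pairs : IsClosed {p : L × L | p.1 ≤ p.2} := by
  have h : {p : L × L | p.1 ≤ p.2} = {p : L × L | p.1 ⊓ p.2 = p.1} := by
    ext p
    exact inf_eq_left.symm
  rw [h]
  exact isClosed_eq continuous_inf continuous_fst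

theorem isClosed_lower (a : L) : IsClosed (Set.Iic a) :=
  (isClosed_le_pairs (L := L)).preimage (f := fun x : L => (x, a)) (by fun_prop)

theorem isClosed_upper (a : L) : IsClosed (Set.Ici a) :=
  (isClosed_le_pairs (L := L)).preimage (f := fun x : L => (a, x)) (by fun_prop)

/-- A closed set containing a nonempty directed set in a compact Lawson lattice contains a
supremum of the directed set. -/
theorem exists_isLUB_mem [CompactSpace L] {D : Set L} (hne : D.Nonempty)
    (hdir : DirectedOn (· ≤ ·) D) {F : Set L} (hF : IsClosed F) (hDF : D ⊆ F) :
    ∃ s ∈ F, IsLUB D s := by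
  have : Nonempty D := hne.to_subtype
  -- a point of `F`, above all of `D`, in the closure of `D` has to be the supremum
  have key : (⋂ d : D, (closure (D ∩ Set.Ici (d : L)))).Nonempty := by
    apply IsCompact.nonempty_iInter_of_directed_nonempty_isCompact_isClosed
    · intro a b
      obtain ⟨c, hc, hac, hbc⟩ := hdir a a.2 b b.2
      refine ⟨⟨c, hc⟩, ?_, ?_⟩
      · exact closure_mono fun x hx => ⟨hx.1, hac.trans hx.2⟩
      · exact closure_mono fun x hx => ⟨hx.1, hbc.trans hx.2⟩
    · intro d
      exact ⟨d, subset_closure ⟨d.2, le_refl (d : L)⟩⟩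
    · intro d
      exact isClosed_closure.isCompact
    · intro d
      exact isClosed_closure
  obtain ⟨s, hs⟩ := key
  rw [Set.mem_iInter] at hs
  refine ⟨s, ?_, ?_, ?_⟩
  · obtain ⟨d, hd⟩ := hne
    exact closure_minimal (fun x hx => hDF hx.1) hF (hs ⟨d, hd⟩)
  · intro d hd
    exact closure_minimal (fun x hx => hx.2) (isClosed_upper d) (hs ⟨d, hd⟩)
  · intro u hu
    obtain ⟨d, hd⟩ := hne
    exact closure_minimal (fun x hx => hu hx.1) (isClosed_lower u) (hs ⟨d, hd⟩)

/-- In a compact Lawson lattice every element is the supremum of the elements way below it. -/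
theorem le_of_wayBelow_le [CompactSpace L] {a u : L} (h : ∀ b, WayBelow b a → b ≤ u) :
    a ≤ u := by
  by_contra hau
  have hU : (Set.Iic u)ᶜ ∈ 𝓝 a := (isClosed_lower u).isOpen_compl.mem_nhds hau
  obtain ⟨W, hW, hWc, hWU⟩ := exists_mem_nhds_isClosed_subset hU
  obtain ⟨V, hV, hVW, hVinf⟩ := LawsonLattice.inf_base a W hW
  -- the meet-subsemilattice `V` has a lower bound in `W`
  have key : (⋂ v : V, (closure (V ∩ Set.Iic (v : L)))).Nonempty := by
    have : Nonempty V := ⟨⟨a, mem_of_mem_nhds hV⟩⟩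
    apply IsCompact.nonempty_iInter_of_directed_nonempty_isCompact_isClosed
    · intro x y
      refine ⟨⟨(x : L) ⊓ y, hVinf x.2 y.2⟩, ?_, ?_⟩
      · exact closure_mono fun z hz => ⟨hz.1, le_trans hz.2 inf_le_left⟩
      · exact closure_mono fun z hz => ⟨hz.1, le_trans hz.2 inf_le_right⟩
    · intro d
      exact ⟨d, subset_closure ⟨d.2, le_refl (d : L)⟩⟩
    · intro d
      exact isClosed_closure.isCompact
    · intro d
      exact isClosed_closure
  obtain ⟨m, hm⟩ := key
  rw [Set.mem_iInter] at hm
  have hmW : m ∈ W :=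
    closure_minimal (fun x hx => hVW hx.1) hWc (hm ⟨a, mem_of_mem_nhds hV⟩)
  have hmV : ∀ v ∈ V, m ≤ v := fun v hv =>
    closure_minimal (fun x hx => hx.2) (isClosed_lower v) (hm ⟨v, hv⟩)
  refine hWU hmW (h m ?_)
  intro D hne hdir s hs has
  by_contra hno
  push Not at hno
  -- otherwise the sets `d ⊓ a` avoid the interior of `V`, but `a` is their supremum
  have hD' : DirectedOn (· ≤ ·) ((fun d => d ⊓ a) '' D) := by
    rintro _ ⟨x, hx, rfl⟩ _ ⟨y, hy, rfl⟩
    obtain ⟨z, hz, hxz, hyz⟩ := hdir x hx y hy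
    exact ⟨_, ⟨z, hz, rfl⟩, inf_le_inf_right a hxz, inf_le_inf_right a hyz⟩
  obtain ⟨t, ht, htlub⟩ := exists_isLUB_mem (hne.image _) hD'
    (F := (interior V)ᶜ) isOpen_interior.isClosed_compl (by
      rintro _ ⟨x, hx, rfl⟩ hxV
      exact hno x hx ((hmV _ (interior_subset hxV)).trans inf_le_left))
  -- `s ⊓ a = a` lies in the closed set of elements `x` with `x ⊓ a ≤ t`
  have hst : s ⊓ a ≤ t := by
    have hcl : IsClosed {x : L | x ⊓ a ≤ t} :=
      (isClosed_lower t).preimage (continuous_id.inf continuous_const)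
    obtain ⟨s', hs', hs'lub⟩ := exists_isLUB_mem hne hdir hcl
      (fun x hx => htlub.1 ⟨x, hx, rfl⟩)
    rw [hs.unique hs'lub]
    exact hs'
  have hta : t = a := by
    apply le_antisymm
    · apply htlub.2
      rintro _ ⟨x, hx, rfl⟩
      exact inf_le_right
    · rwa [inf_eq_right.2 has] at hst
  exact ht (hta ▸ mem_interior_iff_mem_nhds.2 hV)

/-- If `I` is a nonempty directed lower set with supremum `s`, then all elements way below `a`
are in `I` if and only if `a ≤ s`. -/
theorem forall_wayBelow_mem_iff [CompactSpace L] {I : Set L} (hne : I.Nonempty)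
    (hdir : DirectedOn (· ≤ ·) I) (hlow : ∀ x ∈ I, ∀ y, y ≤ x → y ∈ I) {s : L} (hs : IsLUB I s)
    (a : L) : (∀ b, WayBelow b a → b ∈ I) ↔ a ≤ s := by
  constructor
  · intro h
    exact le_of_wayBelow_le fun b hb => hs.1 (h b hb)
  · intro h b hb
    obtain ⟨c, hc, hbc⟩ := hb I hne hdir s hs h
    exact hlow c hc b hbc

end LatticeFacts

/-! ### Crisp ambiguous representations

For a compactum `X`, the hyperspace of nonempty closed subsets with the Vietoris topology is
`NonemptyCompacts X`. -/

section Crisp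

variable {X : Type u} {Y : Type v} [TopologicalSpace X] [TopologicalSpace Y]

/-- `R` is an ambiguous representation between `X` and `Y`. -/
structure IsAmbiguous (R : Set (NonemptyCompacts X × NonemptyCompacts Y)) : Prop where
  mono : ∀ A A' : NonemptyCompacts X, ∀ B B' : NonemptyCompacts Y,
    A' ≤ A → B ≤ B' → (A, B) ∈ R → (A', B') ∈ R
  whole : ∀ A : NonemptyCompacts X, ∀ B : NonemptyCompacts Y, (B : Set Y) = univ → (A, B) ∈ R
  closed : ∀ A : NonemptyCompacts X, IsClosed {B : NonemptyCompacts Y | (A, B) ∈ R}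

/-- A strict ambiguous representation: also the sets `RB` are closed. -/
structure IsStrictAmbiguous (R : Set (NonemptyCompacts X × NonemptyCompacts Y)) : Prop
    extends IsAmbiguous R where
  closed_left : ∀ B : NonemptyCompacts Y, IsClosed {A : NonemptyCompacts X | (A, B) ∈ R}

/-- The crisp relation `R⁻¹`: `(B, A) ∈ R⁻¹` if and only if every `A'` disjoint from `A` is
related by `R` to some `B'` disjoint from `B`. -/
def crispInv (R : Set (NonemptyCompacts X × NonemptyCompacts Y)) :
    Set (NonemptyCompacts Y × NonemptyCompacts X) :=
  {p | ∀ A' : NonemptyCompacts X, Disjoint (A' : Set X) (p.2 : Set X) →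
    ∃ B' : NonemptyCompacts Y, (A', B') ∈ R ∧ Disjoint (B' : Set Y) (p.1 : Set Y)}

/-- An open ambiguous representation: strict, pseudo-invertible, with strict pseudo-inverse. -/
structure IsOpenAmbiguous (R : Set (NonemptyCompacts X × NonemptyCompacts Y)) : Prop where
  strict : IsStrictAmbiguous R
  pseudoInvertible : crispInv (crispInv R) = R
  strict_inv : IsStrictAmbiguous (crispInv R)

end Crisp

/-! ### `L`-ambiguous representations -/

/-- An `L`-ambiguous representation between `X` and `Y`. -/
@[ext]
structure LAmb (X : Type u) (Y : Type v) (L : Type w) [TopologicalSpace X] [TopologicalSpace Y]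
    [DistribLattice L] [BoundedOrder L] [TopologicalSpace L] where
  /-- the underlying set of triples -/
  carrier : Set (NonemptyCompacts X × NonemptyCompacts Y × L)
  mono : ∀ A A' : NonemptyCompacts X, ∀ B B' : NonemptyCompacts Y, ∀ α α' : L,
    A' ≤ A → B ≤ B' → α' ≤ α → (A, B, α) ∈ carrier → (A', B', α') ∈ carrier
  sup_mem : ∀ A : NonemptyCompacts X, ∀ B : NonemptyCompacts Y, ∀ α β : L,
    (A, B, α) ∈ carrier → (A, B, β) ∈ carrier → (A, B, α ⊔ β) ∈ carrier
  whole : ∀ A : NonemptyCompacts X, ∀ B : NonemptyCompacts Y, ∀ α : L,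
    (B : Set Y) = univ → (A, B, α) ∈ carrier
  bot_mem : ∀ A : NonemptyCompacts X, ∀ B : NonemptyCompacts Y, (A, B, ⊥) ∈ carrier
  closed : ∀ A : NonemptyCompacts X,
    IsClosed {p : NonemptyCompacts Y × L | (A, p.1, p.2) ∈ carrier}

section Cuts

variable {X : Type u} {Y : Type v} {L : Type w} [TopologicalSpace X] [TopologicalSpace Y]

/-- The `α`-cut of a set of triples. -/
def cut (R : Set (NonemptyCompacts X × NonemptyCompacts Y × L)) (α : L) :
    Set (NonemptyCompacts X × NonemptyCompacts Y) :=
  {p | (p.1, p.2, α) ∈ R}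

/-- The set of triples `R⁻¹`. Its cut at `α ≠ ⊥` is the intersection of the crisp relations
`(R_β)⁻¹` over all `β` way below `α`, and its cut at `⊥` is the full relation. -/
def invSet [Preorder L] [OrderBot L] (R : Set (NonemptyCompacts X × NonemptyCompacts Y × L)) :
    Set (NonemptyCompacts Y × NonemptyCompacts X × L) :=
  {p | p.2.2 = ⊥ ∨ ∀ β : L, WayBelow β p.2.2 → (p.1, p.2.1) ∈ crispInv (cut R β)}

end Cuts

namespace LAmb

variable {X : Type u} {Y : Type v} {L : Type w} [TopologicalSpace X] [TopologicalSpace Y]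
  [DistribLattice L] [BoundedOrder L] [TopologicalSpace L]

/-- `L`-ambiguous representations are ordered by inclusion. -/
instance : PartialOrder (LAmb X Y L) :=
  PartialOrder.lift LAmb.carrier fun _ _ h => LAmb.ext h

/-- The join of two `L`-ambiguous representations. -/
def join [T2Space Y] [CompactSpace Y] [T2Space L] [CompactSpace L] [LawsonLattice L]
    (R S : LAmb X Y L) : LAmb X Y L where
  carrier := {p | ∃ α₁ α₂ : L, (p.1, p.2.1, α₁) ∈ R.carrier ∧ (p.1, p.2.1, α₂) ∈ S.carrier ∧
    p.2.2 = α₁ ⊔ α₂}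
  mono := by
    rintro A A' B B' α α' hA hB hα ⟨α₁, α₂, h₁, h₂, h⟩
    refine ⟨α' ⊓ α₁, α' ⊓ α₂, R.mono A A' B B' α₁ _ hA hB inf_le_right h₁,
      S.mono A A' B B' α₂ _ hA hB inf_le_right h₂, ?_⟩
    change α = α₁ ⊔ α₂ at h
    change α' = _
    rw [← inf_sup_left, ← h, inf_eq_left.2 hα]
  sup_mem := by
    rintro A B α β ⟨α₁, α₂, h₁, h₂, h⟩ ⟨β₁, β₂, k₁, k₂, k⟩
    refine ⟨α₁ ⊔ β₁, α₂ ⊔ β₂, R.sup_mem _ _ _ _ h₁ k₁, S.sup_mem _ _ _ _ h₂ k₂, ?_⟩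
    change α = α₁ ⊔ α₂ at h
    change β = β₁ ⊔ β₂ at k
    change α ⊔ β = _
    rw [h, k, sup_sup_sup_comm]
  whole A B α hB := ⟨α, α, R.whole A B α hB, S.whole A B α hB, (sup_idem α).symm⟩
  bot_mem A B := ⟨⊥, ⊥, R.bot_mem A B, S.bot_mem A B, (sup_idem _).symm⟩
  closed A := by
    have hK : IsClosed {q : NonemptyCompacts Y × L × L |
        (A, q.1, q.2.1) ∈ R.carrier ∧ (A, q.1, q.2.2) ∈ S.carrier} :=
      ((R.closed A).preimage (f := fun q : NonemptyCompacts Y × L × L => (q.1, q.2.1))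
        (by fun_prop)).inter
      ((S.closed A).preimage (f := fun q : NonemptyCompacts Y × L × L => (q.1, q.2.2))
        (by fun_prop))
    have hf : Continuous (fun q : NonemptyCompacts Y × L × L => (q.1, q.2.1 ⊔ q.2.2)) := by
      fun_prop
    convert (hK.isCompact.image hf).isClosed using 1
    ext ⟨B, γ⟩
    constructor
    · rintro ⟨α₁, α₂, h₁, h₂, h⟩
      exact ⟨(B, α₁, α₂), ⟨h₁, h₂⟩, Prod.ext rfl h.symm⟩
    · rintro ⟨⟨B', α₁, α₂⟩, ⟨h₁, h₂⟩, h⟩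
      obtain ⟨rfl, rfl⟩ := Prod.mk.inj h
      exact ⟨α₁, α₂, h₁, h₂, rfl⟩

/-- The meet of two `L`-ambiguous representations is their intersection. -/
def meet (R S : LAmb X Y L) : LAmb X Y L where
  carrier := R.carrier ∩ S.carrier
  mono A A' B B' α α' hA hB hα h :=
    ⟨R.mono A A' B B' α α' hA hB hα h.1, S.mono A A' B B' α α' hA hB hα h.2⟩
  sup_mem A B α β h k := ⟨R.sup_mem A B α β h.1 k.1, S.sup_mem A B α β h.2 k.2⟩
  whole A B α hB := ⟨R.whole A B α hB, S.whole A B α hB⟩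
  bot_mem A B := ⟨R.bot_mem A B, S.bot_mem A B⟩
  closed A := (R.closed A).inter (S.closed A)

/-- The lattice of all `L`-ambiguous representations between `X` and `Y`, ordered by inclusion. -/
instance [T2Space Y] [CompactSpace Y] [T2Space L] [CompactSpace L] [LawsonLattice L] :
    Lattice (LAmb X Y L) where
  sup := join
  inf := meet
  le_sup_left R S := fun ⟨A, B, α⟩ h => ⟨α, ⊥, h, S.bot_mem A B, (sup_bot_eq α).symm⟩
  le_sup_right R S := fun ⟨A, B, α⟩ h => ⟨⊥, α, R.bot_mem A B, h, (bot_sup_eq α).symm⟩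
  sup_le R S T hR hS := by
    rintro ⟨A, B, α⟩ ⟨α₁, α₂, h₁, h₂, h⟩
    change α = α₁ ⊔ α₂ at h
    rw [h]
    exact T.sup_mem A B α₁ α₂ (hR h₁) (hS h₂)
  inf_le_left _ _ := Set.inter_subset_left
  inf_le_right _ _ := Set.inter_subset_right
  le_inf _ _ _ h k := Set.subset_inter h k

/-- The degrees with which `A'` is represented through `R` by a set disjoint from `B`. -/
def avoid (R : LAmb X Y L) (A' : NonemptyCompacts X) (B : NonemptyCompacts Y) : Set L :=
  {β | ∃ B' : NonemptyCompacts Y, (A', B', β) ∈ R.carrier ∧ Disjoint (B' : Set Y) (B : Set Y)}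

theorem avoid_lower (R : LAmb X Y L) (A' : NonemptyCompacts X) (B : NonemptyCompacts Y) :
    ∀ x ∈ R.avoid A' B, ∀ y, y ≤ x → y ∈ R.avoid A' B := by
  rintro x ⟨B', h, hd⟩ y hy
  exact ⟨B', R.mono _ _ _ _ _ _ le_rfl le_rfl hy h, hd⟩

theorem avoid_sup (R : LAmb X Y L) (A' : NonemptyCompacts X) (B : NonemptyCompacts Y) {x y : L}
    (hx : x ∈ R.avoid A' B) (hy : y ∈ R.avoid A' B) : x ⊔ y ∈ R.avoid A' B := by
  obtain ⟨B₁, h₁, hd₁⟩ := hx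
  obtain ⟨B₂, h₂, hd₂⟩ := hy
  refine ⟨B₁ ⊔ B₂, R.sup_mem _ _ _ _
    (R.mono _ _ _ _ _ _ le_rfl le_sup_left le_rfl h₁)
    (R.mono _ _ _ _ _ _ le_rfl le_sup_right le_rfl h₂), ?_⟩
  rw [NonemptyCompacts.coe_sup]
  exact hd₁.union_left hd₂

theorem avoid_directed (R : LAmb X Y L) (A' : NonemptyCompacts X) (B : NonemptyCompacts Y) :
    DirectedOn (· ≤ ·) (R.avoid A' B) := fun _ hx _ hy =>
  ⟨_, R.avoid_sup A' B hx hy, le_sup_left, le_sup_right⟩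

theorem mem_invSet (R : LAmb X Y L) {A : NonemptyCompacts X} {B : NonemptyCompacts Y} {α : L} :
    (B, A, α) ∈ invSet R.carrier ↔ α = ⊥ ∨ ∀ A' : NonemptyCompacts X,
      Disjoint (A' : Set X) (A : Set X) → ∀ β, WayBelow β α → β ∈ R.avoid A' B :=
  or_congr Iff.rfl ⟨fun h A' hd β hβ => h β hβ A' hd, fun h β hβ A' hd => h A' hd β hβ⟩

variable [T2Space L] [CompactSpace L] [LawsonLattice L]

/-- The elements all of whose way-below elements are in `avoid` form a closed set, which is closed
under joins. -/
theorem avoid_wayBelow (R : LAmb X Y L) (A' : NonemptyCompacts X) (B : NonemptyCompacts Y) :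
    IsClosed {α : L | ∀ β, WayBelow β α → β ∈ R.avoid A' B} ∧
      SupClosed {α : L | ∀ β, WayBelow β α → β ∈ R.avoid A' B} := by
  by_cases hne : (R.avoid A' B).Nonempty
  · obtain ⟨s, -, hs⟩ :=
      exists_isLUB_mem hne (R.avoid_directed A' B) isClosed_univ (subset_univ _)
    have h : {α : L | ∀ β, WayBelow β α → β ∈ R.avoid A' B} = Set.Iic s := by
      ext α
      exact forall_wayBelow_mem_iff hne (R.avoid_directed A' B) (R.avoid_lower A' B) hs α
    rw [h]
    exact ⟨isClosed_lower s, fun x hx y hy => sup_le hx hy⟩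
  · have h : {α : L | ∀ β, WayBelow β α → β ∈ R.avoid A' B} = ∅ := by
      ext α
      simp only [mem_ofPred_eq, mem_empty_iff_false, iff_false]
      exact fun h => hne ⟨⊥, h ⊥ (wayBelow_bot α)⟩
    rw [h]
    exact ⟨isClosed_empty, supClosed_empty⟩

/-- The `L`-ambiguous representation `R⁻¹` between `Y` and `X`. -/
def pinv [T2Space X] (R : LAmb X Y L) : LAmb Y X L where
  carrier := invSet R.carrier
  mono := by
    intro B B' A A' α α' hB hA hα h
    rw [mem_invSet] at h ⊢
    rcases h with rfl | h
    · exact Or.inl (le_bot_iff.1 hα)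
    · refine Or.inr fun C hC β hβ => ?_
      obtain ⟨B₁, h₁, hd⟩ := h C (hC.mono_right hA) β (hβ.of_le le_rfl hα)
      exact ⟨B₁, h₁, hd.mono_right hB⟩
  sup_mem := by
    intro B A α β hα hβ
    rcases R.mem_invSet.1 hα with rfl | hα'
    · rwa [bot_sup_eq]
    rcases R.mem_invSet.1 hβ with rfl | hβ'
    · rwa [sup_bot_eq]
    exact R.mem_invSet.2 (Or.inr fun C hC =>
      (R.avoid_wayBelow C B).2 (hα' C hC) (hβ' C hC))
  whole B A α hA := by
    refine R.mem_invSet.2 (Or.inr fun C hC => ?_)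
    rw [hA, disjoint_univ] at hC
    exact absurd hC C.nonempty.ne_empty
  bot_mem _ _ := Or.inl rfl
  closed B := by
    have h : {p : NonemptyCompacts X × L | (B, p.1, p.2) ∈ invSet R.carrier} =
        {p | p.2 = ⊥} ∪ ⋂ A' : NonemptyCompacts X,
          ({p | ((p.1 : Set X) ∩ A').Nonempty} ∪
            {p | ∀ β, WayBelow β p.2 → β ∈ R.avoid A' B}) := by
      ext ⟨A, α⟩
      rw [mem_ofPred_eq, mem_invSet, mem_union, mem_iInter]
      refine or_congr Iff.rfl (forall_congr' fun A' => ?_)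
      rw [mem_union, mem_ofPred_eq, ← not_disjoint_iff_nonempty_inter, disjoint_comm,
        ← imp_iff_not_or]
      rfl
    rw [h]
    refine (isClosed_eq continuous_snd continuous_const).union (isClosed_iInter fun A' =>
      IsClosed.union ?_ ?_)
    · exact (NonemptyCompacts.isClosed_inter_nonempty_of_isClosed A'.isCompact.isClosed).preimage
        continuous_fst
    · exact (R.avoid_wayBelow A' B).1.preimage continuous_snd

/-- `R` is pseudo-invertible (and then `R⁻¹` is its pseudo-inverse) if `(R⁻¹)⁻¹ = R`. -/
def PseudoInvertible [T2Space X] [T2Space Y] (R : LAmb X Y L) : Prop :=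
  R.pinv.pinv = R

end LAmb

namespace LAmb

variable {X : Type u} {Y : Type v} {L : Type w} [TopologicalSpace X] [TopologicalSpace Y]
  [DistribLattice L] [BoundedOrder L] [TopologicalSpace L]

/-- `R` is strict if all the sets `RB` are closed. -/
def IsStrict (R : LAmb X Y L) : Prop :=
  ∀ B : NonemptyCompacts Y, IsClosed {p : NonemptyCompacts X × L | (p.1, B, p.2) ∈ R.carrier}

/-- `R` is open if it is strict and pseudo-invertible and its pseudo-inverse is strict. -/
structure IsOpen [T2Space L] [CompactSpace L] [LawsonLattice L] [T2Space X] [T2Space Y]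
    (R : LAmb X Y L) : Prop where
  strict : R.IsStrict
  strict_pinv : R.pinv.IsStrict
  pseudoInvertible : R.PseudoInvertible

end LAmb

end AmbRep

namespace AmbRep

universe u v w

/-! ### The crisp case. -/

section CrispInverse

variable {X : Type u} {Y : Type v} [TopologicalSpace X] [TopologicalSpace Y]
  {R S : Set (NonemptyCompacts X × NonemptyCompacts Y)}

/-! Inversion is monotone, so one inclusion in each identity is free. For meets, the other holds
because two witnesses disjoint from `B` have a union disjoint from `B`. For crisp unions, two
counterexamples `A'` are merged in the same way.

The join over `L` is the substantial case (`pinv_sup`). For fixed `A'`, the degrees in `avoid A' B`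
form an ideal, if there are any; let `r` and `s` be its suprema for `R` and `S`. A degree `α`
allowed for `R ⊔ S` satisfies `α ≤ r ⊔ s`, so by distributivity `α = (α ⊓ r) ⊔ (α ⊓ s)`
(`exists_sup_eq_of_avoid_sup`). This splitting depends on `A'`, but the admissible pairs form a
closed subset of `L × L` that shrinks as `A'` grows, so compactness gives one pair valid for every
`A'`.

The closure statements follow by applying the identities to `R`, `S` and then to their inverses;
strictness of a join comes from compactness. -/

theorem crispInv_mono (h : R ⊆ S) : crispInv R ⊆ crispInv S := by
  intro p hp A' hA'
  obtain ⟨B', hB', hd⟩ := hp A' hA'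
  exact ⟨B', h hB', hd⟩

theorem IsAmbiguous.inter (hR : IsAmbiguous R) (hS : IsAmbiguous S) : IsAmbiguous (R ∩ S) where
  mono A A' B B' hA hB h := ⟨hR.mono A A' B B' hA hB h.1, hS.mono A A' B B' hA hB h.2⟩
  whole A B h := ⟨hR.whole A B h, hS.whole A B h⟩
  closed A := (hR.closed A).inter (hS.closed A)

theorem IsAmbiguous.union (hR : IsAmbiguous R) (hS : IsAmbiguous S) : IsAmbiguous (R ∪ S) where
  mono A A' B B' hA hB h := h.imp (hR.mono A A' B B' hA hB) (hS.mono A A' B B' hA hB)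
  whole A B h := Or.inl (hR.whole A B h)
  closed A := (hR.closed A).union (hS.closed A)

theorem IsStrictAmbiguous.inter (hR : IsStrictAmbiguous R) (hS : IsStrictAmbiguous S) :
    IsStrictAmbiguous (R ∩ S) where
  toIsAmbiguous := hR.toIsAmbiguous.inter hS.toIsAmbiguous
  closed_left B := (hR.closed_left B).inter (hS.closed_left B)

theorem IsStrictAmbiguous.union (hR : IsStrictAmbiguous R) (hS : IsStrictAmbiguous S) :
    IsStrictAmbiguous (R ∪ S) where
  toIsAmbiguous := hR.toIsAmbiguous.union hS.toIsAmbiguous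
  closed_left B := (hR.closed_left B).union (hS.closed_left B)

/-- The crisp inverse preserves intersections: take the union of the two witnesses. -/
theorem crispInv_inter (hR : IsAmbiguous R) (hS : IsAmbiguous S) :
    crispInv (R ∩ S) = crispInv R ∩ crispInv S := by
  refine Subset.antisymm
    (subset_inter (crispInv_mono inter_subset_left) (crispInv_mono inter_subset_right)) ?_
  rintro p ⟨hp, hq⟩ A' hA'
  obtain ⟨B₁, h₁, hd₁⟩ := hp A' hA'
  obtain ⟨B₂, h₂, hd₂⟩ := hq A' hA'
  refine ⟨B₁ ⊔ B₂, ⟨hR.mono _ _ _ _ le_rfl le_sup_left h₁,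
    hS.mono _ _ _ _ le_rfl le_sup_right h₂⟩, ?_⟩
  rw [NonemptyCompacts.coe_sup]
  exact hd₁.union_left hd₂

/-- The crisp inverse preserves unions: the union of two counterexamples is a counterexample. -/
theorem crispInv_union (hR : IsAmbiguous R) (hS : IsAmbiguous S) :
    crispInv (R ∪ S) = crispInv R ∪ crispInv S := by
  refine Subset.antisymm ?_
    (union_subset (crispInv_mono subset_union_left) (crispInv_mono subset_union_right))
  intro p hp
  by_contra hno
  rw [mem_union, not_or] at hno
  obtain ⟨hno₁, hno₂⟩ := hno
  simp only [crispInv, mem_ofPred_eq, not_forall] at hno₁ hno₂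
  obtain ⟨A₁, hd₁, h₁⟩ := hno₁
  obtain ⟨A₂, hd₂, h₂⟩ := hno₂
  obtain ⟨B', hB' | hB', hd⟩ := hp (A₁ ⊔ A₂) (by
    rw [NonemptyCompacts.coe_sup]
    exact hd₁.union_left hd₂)
  · exact h₁ ⟨B', hR.mono _ _ _ _ le_sup_left le_rfl hB', hd⟩
  · exact h₂ ⟨B', hS.mono _ _ _ _ le_sup_right le_rfl hB', hd⟩

/-- The second inversion needs the inverses to be ambiguous themselves, which `strict_inv` supplies.
-/
theorem IsOpenAmbiguous.inter (hR : IsOpenAmbiguous R) (hS : IsOpenAmbiguous S) :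
    IsOpenAmbiguous (R ∩ S) := by
  have h := crispInv_inter hR.strict.toIsAmbiguous hS.strict.toIsAmbiguous
  refine ⟨hR.strict.inter hS.strict, ?_, ?_⟩
  · rw [h, crispInv_inter hR.strict_inv.toIsAmbiguous hS.strict_inv.toIsAmbiguous,
      hR.pseudoInvertible, hS.pseudoInvertible]
  · rw [h]
    exact hR.strict_inv.inter hS.strict_inv

theorem IsOpenAmbiguous.union (hR : IsOpenAmbiguous R) (hS : IsOpenAmbiguous S) :
    IsOpenAmbiguous (R ∪ S) := by
  have h := crispInv_union hR.strict.toIsAmbiguous hS.strict.toIsAmbiguous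
  refine ⟨hR.strict.union hS.strict, ?_, ?_⟩
  · rw [h, crispInv_union hR.strict_inv.toIsAmbiguous hS.strict_inv.toIsAmbiguous,
      hR.pseudoInvertible, hS.pseudoInvertible]
  · rw [h]
    exact hR.strict_inv.union hS.strict_inv

end CrispInverse

/-! ### Inverses of `L`-valued meets and joins. -/

namespace LAmb

variable {X : Type u} {Y : Type v} {L : Type w} [TopologicalSpace X] [TopologicalSpace Y]
  [DistribLattice L] [BoundedOrder L] [TopologicalSpace L]

/-- Being antitone in the first set is what makes the compactness argument in `pinv_sup` directed.
-/
theorem avoid_mono {R S : LAmb X Y L} (h : R ≤ S) {A A' : NonemptyCompacts X} (hA : A ≤ A')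
    (B : NonemptyCompacts Y) : R.avoid A' B ⊆ S.avoid A B := by
  rintro β ⟨B', hB', hd⟩
  exact ⟨B', S.mono _ _ _ _ _ _ hA le_rfl le_rfl (h hB'), hd⟩

variable [T2Space L] [CompactSpace L] [LawsonLattice L]

theorem pinv_mono [T2Space X] {R S : LAmb X Y L} (h : R ≤ S) : R.pinv ≤ S.pinv := by
  rintro ⟨B, A, α⟩ hp
  exact S.mem_invSet.2 ((R.mem_invSet.1 hp).imp_right
    fun hp A' hA' β hβ => avoid_mono h le_rfl B (hp A' hA' β hβ))

section Inverse

variable [CompactSpace Y] [T2Space Y]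

theorem avoid_inf (R S : LAmb X Y L) (A : NonemptyCompacts X) (B : NonemptyCompacts Y) :
    (R ⊓ S).avoid A B = R.avoid A B ∩ S.avoid A B := by
  refine Subset.antisymm
    (subset_inter (avoid_mono inf_le_left le_rfl B) (avoid_mono inf_le_right le_rfl B)) ?_
  rintro β ⟨⟨B₁, h₁, hd₁⟩, B₂, h₂, hd₂⟩
  refine ⟨B₁ ⊔ B₂, ⟨R.mono _ _ _ _ _ _ le_rfl le_sup_left le_rfl h₁,
    S.mono _ _ _ _ _ _ le_rfl le_sup_right le_rfl h₂⟩, ?_⟩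
  rw [NonemptyCompacts.coe_sup]
  exact hd₁.union_left hd₂

/-- If all elements way below `α` are degrees of avoidance for `R ⊔ S`, then `α` is a join of
two elements with the same property for `R` and for `S`. -/
theorem exists_sup_eq_of_avoid_sup (R S : LAmb X Y L) (A : NonemptyCompacts X)
    (B : NonemptyCompacts Y) {α : L} (h : ∀ β, WayBelow β α → β ∈ (R ⊔ S).avoid A B) :
    ∃ x y : L, (∀ β, WayBelow β x → β ∈ R.avoid A B) ∧
      (∀ β, WayBelow β y → β ∈ S.avoid A B) ∧ x ⊔ y = α := by
  -- Since `⊥` is way below everything, some `B₀` misses `B`; hence both ideals contain `⊥` and have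
  -- suprema.
  obtain ⟨B₀, -, hd₀⟩ := h ⊥ (wayBelow_bot α)
  have hR : (R.avoid A B).Nonempty := ⟨⊥, B₀, R.bot_mem A B₀, hd₀⟩
  have hS : (S.avoid A B).Nonempty := ⟨⊥, B₀, S.bot_mem A B₀, hd₀⟩
  obtain ⟨r, -, hr⟩ := exists_isLUB_mem hR (R.avoid_directed A B) isClosed_univ (subset_univ _)
  obtain ⟨s, -, hs⟩ := exists_isLUB_mem hS (S.avoid_directed A B) isClosed_univ (subset_univ _)
  have hα : α ≤ r ⊔ s := by
    refine le_of_wayBelow_le fun β hβ => ?_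
    obtain ⟨B', ⟨β₁, β₂, h₁, h₂, hβ'⟩, hd⟩ := h β hβ
    change β = β₁ ⊔ β₂ at hβ'
    rw [hβ']
    exact sup_le_sup (hr.1 ⟨B', h₁, hd⟩) (hs.1 ⟨B', h₂, hd⟩)
  -- Truncating `r` and `s` by `α` makes the join exactly `α`, by distributivity.
  refine ⟨α ⊓ r, α ⊓ s, ?_, ?_, ?_⟩
  · exact (forall_wayBelow_mem_iff hR (R.avoid_directed A B) (R.avoid_lower A B) hr _).2
      inf_le_right
  · exact (forall_wayBelow_mem_iff hS (S.avoid_directed A B) (S.avoid_lower A B) hs _).2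
      inf_le_right
  · rw [← inf_sup_left, inf_eq_left.2 hα]

theorem IsStrict.inf {R S : LAmb X Y L} (hR : R.IsStrict) (hS : S.IsStrict) : (R ⊓ S).IsStrict :=
  fun B => (hR B).inter (hS B)

variable [CompactSpace X] [T2Space X]

theorem pinv_inf (R S : LAmb X Y L) : (R ⊓ S).pinv = R.pinv ⊓ S.pinv := by
  refine le_antisymm (le_inf (pinv_mono inf_le_left) (pinv_mono inf_le_right)) ?_
  rintro ⟨B, A, α⟩ ⟨hR, hS⟩
  refine (R ⊓ S).mem_invSet.2 ?_
  rcases R.mem_invSet.1 hR with h | hR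
  · exact Or.inl h
  rcases S.mem_invSet.1 hS with h | hS
  · exact Or.inl h
  refine Or.inr fun A' hA' β hβ => ?_
  rw [avoid_inf]
  exact ⟨hR A' hA' β hβ, hS A' hA' β hβ⟩

theorem pinv_sup (R S : LAmb X Y L) : (R ⊔ S).pinv = R.pinv ⊔ S.pinv := by
  refine le_antisymm ?_ (sup_le (pinv_mono le_sup_left) (pinv_mono le_sup_right))
  rintro ⟨B, A, α⟩ hp
  rcases (R ⊔ S).mem_invSet.1 hp with rfl | h
  · exact (R.pinv ⊔ S.pinv).bot_mem B A
  -- the decompositions of `α` for the various `A'` have a common member by compactness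
  let ι := {A' : NonemptyCompacts X // Disjoint (A' : Set X) (A : Set X)}
  -- If no `A'` misses `A` (for instance `A = X`), the inverse imposes no condition and `α` serves
  -- on both sides.
  rcases isEmpty_or_nonempty ι with hι | hι
  · exact ⟨α, α, R.mem_invSet.2 (Or.inr fun A' hA' => (hι.false ⟨A', hA'⟩).elim),
      S.mem_invSet.2 (Or.inr fun A' hA' => (hι.false ⟨A', hA'⟩).elim), (sup_idem α).symm⟩
  let K : ι → Set (L × L) := fun A' =>
    {p | (∀ β, WayBelow β p.1 → β ∈ R.avoid A'.1 B) ∧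
      (∀ β, WayBelow β p.2 → β ∈ S.avoid A'.1 B) ∧ p.1 ⊔ p.2 = α}
  have hK : ∀ A', IsClosed (K A') := fun A' =>
    ((R.avoid_wayBelow A'.1 B).1.preimage continuous_fst).inter
      (((S.avoid_wayBelow A'.1 B).1.preimage continuous_snd).inter
        (isClosed_eq (continuous_fst.sup continuous_snd) continuous_const))
  have key : (⋂ A', K A').Nonempty := by
    refine IsCompact.nonempty_iInter_of_directed_nonempty_isCompact_isClosed K ?_ ?_
      (fun A' => (hK A').isCompact) hK
    -- The pairs admissible for `A₁ ⊔ A₂` are admissible for both `A₁` and `A₂`.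
    · intro A₁ A₂
      refine ⟨⟨A₁.1 ⊔ A₂.1, ?_⟩, ?_, ?_⟩
      · rw [NonemptyCompacts.coe_sup]
        exact A₁.2.union_left A₂.2
      · exact fun p hp => ⟨fun β hβ => avoid_mono le_rfl le_sup_left B (hp.1 β hβ),
          fun β hβ => avoid_mono le_rfl le_sup_left B (hp.2.1 β hβ), hp.2.2⟩
      · exact fun p hp => ⟨fun β hβ => avoid_mono le_rfl le_sup_right B (hp.1 β hβ),
          fun β hβ => avoid_mono le_rfl le_sup_right B (hp.2.1 β hβ), hp.2.2⟩
    · intro A'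
      obtain ⟨x, y, hx, hy, hxy⟩ := exists_sup_eq_of_avoid_sup R S A'.1 B (h A'.1 A'.2)
      exact ⟨(x, y), hx, hy, hxy⟩
  obtain ⟨⟨x, y⟩, hxy⟩ := key
  rw [mem_iInter] at hxy
  -- The equation `x ⊔ y = α` does not involve `A'`, so it is read off at any index.
  exact ⟨x, y, R.mem_invSet.2 (Or.inr fun A' hA' => (hxy ⟨A', hA'⟩).1),
    S.mem_invSet.2 (Or.inr fun A' hA' => (hxy ⟨A', hA'⟩).2.1), (hxy hι.some).2.2.symm⟩

/-! ### Stability of strictness, pseudo-invertibility and openness. -/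

variable {R S : LAmb X Y L}

/-- For fixed `B`, the section of the join is the continuous image, under joining the two degrees,
of a compact set of triples. -/
theorem IsStrict.sup (hR : R.IsStrict) (hS : S.IsStrict) : (R ⊔ S).IsStrict := by
  intro B
  have hK : IsClosed {q : NonemptyCompacts X × L × L |
      (q.1, B, q.2.1) ∈ R.carrier ∧ (q.1, B, q.2.2) ∈ S.carrier} :=
    ((hR B).preimage (f := fun q : NonemptyCompacts X × L × L => (q.1, q.2.1))
      (by fun_prop)).inter
    ((hS B).preimage (f := fun q : NonemptyCompacts X × L × L => (q.1, q.2.2))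
      (by fun_prop))
  have hf : Continuous (fun q : NonemptyCompacts X × L × L => (q.1, q.2.1 ⊔ q.2.2)) := by
    fun_prop
  convert (hK.isCompact.image hf).isClosed using 1
  ext ⟨A, γ⟩
  constructor
  · rintro ⟨α₁, α₂, h₁, h₂, h⟩
    exact ⟨(A, α₁, α₂), ⟨h₁, h₂⟩, Prod.ext rfl h.symm⟩
  · rintro ⟨⟨A', α₁, α₂⟩, ⟨h₁, h₂⟩, h⟩
    obtain ⟨rfl, rfl⟩ := Prod.mk.inj h
    exact ⟨α₁, α₂, h₁, h₂, rfl⟩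

/-- The second use of `pinv_inf` has `X` and `Y` interchanged, so both spaces must be compact
Hausdorff. -/
theorem PseudoInvertible.inf (hR : R.PseudoInvertible) (hS : S.PseudoInvertible) :
    (R ⊓ S).PseudoInvertible := by
  rw [PseudoInvertible] at *
  rw [pinv_inf, pinv_inf, hR, hS]

theorem PseudoInvertible.sup (hR : R.PseudoInvertible) (hS : S.PseudoInvertible) :
    (R ⊔ S).PseudoInvertible := by
  rw [PseudoInvertible] at *
  rw [pinv_sup, pinv_sup, hR, hS]

theorem IsOpen.inf (hR : R.IsOpen) (hS : S.IsOpen) : (R ⊓ S).IsOpen where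
  strict := hR.strict.inf hS.strict
  strict_pinv := by
    rw [pinv_inf]
    exact hR.strict_pinv.inf hS.strict_pinv
  pseudoInvertible := hR.pseudoInvertible.inf hS.pseudoInvertible

theorem IsOpen.sup (hR : R.IsOpen) (hS : S.IsOpen) : (R ⊔ S).IsOpen where
  strict := hR.strict.sup hS.strict
  strict_pinv := by
    rw [pinv_sup]
    exact hR.strict_pinv.sup hS.strict_pinv
  pseudoInvertible := hR.pseudoInvertible.sup hS.pseudoInvertible

end Inverse

end LAmb

end AmbRep

theorem mainTheorem10 {X : Type*} {Y : Type*} {L : Type*}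
    [TopologicalSpace X] [CompactSpace X] [T2Space X]
    [TopologicalSpace Y] [CompactSpace Y] [T2Space Y]
    [DistribLattice L] [BoundedOrder L] [TopologicalSpace L] [CompactSpace L] [T2Space L]
    [AmbRep.LawsonLattice L] :
    (∀ R S : AmbRep.LAmb X Y L,
      (R ⊔ S).pinv = R.pinv ⊔ S.pinv ∧ (R ⊓ S).pinv = R.pinv ⊓ S.pinv) ∧
    IsSublattice {R : AmbRep.LAmb X Y L | R.PseudoInvertible} ∧
    IsSublattice {R : AmbRep.LAmb X Y L | R.PseudoInvertible ∧ R.IsStrict} ∧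
    IsSublattice {R : AmbRep.LAmb X Y L | R.IsOpen} ∧
    (∀ R S : Set (TopologicalSpace.NonemptyCompacts X × TopologicalSpace.NonemptyCompacts Y),
      AmbRep.IsOpenAmbiguous R → AmbRep.IsOpenAmbiguous S →
        AmbRep.IsOpenAmbiguous (R ∩ S) ∧ AmbRep.IsOpenAmbiguous (R ∪ S)) := by
  exact ⟨fun R S => ⟨AmbRep.LAmb.pinv_sup R S, AmbRep.LAmb.pinv_inf R S⟩,
    ⟨fun _ hR _ hS => hR.sup hS, fun _ hR _ hS => hR.inf hS⟩,
    ⟨fun _ hR _ hS => ⟨hR.1.sup hS.1, hR.2.sup hS.2⟩,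
      fun _ hR _ hS => ⟨hR.1.inf hS.1, hR.2.inf hS.2⟩⟩,
    ⟨fun _ hR _ hS => hR.sup hS, fun _ hR _ hS => hR.inf hS⟩,
    fun _ _ hR hS => ⟨hR.inter hS, hR.union hS⟩⟩
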